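/- All cardinal invariants are taken to be infinite. For a topological space $X$, let $w(X)$ be its weight, i.e. $\omega$ plus the least cardinality of a base of $X$; let $l(X)$ be its Lindelöf number, i.e. $\omega$ plus the least cardinal $\tau$ such that every open cover of $X$ has a subcover of cardinality at most $\tau$; let $hl(X)=\sup\{l(M): M\subseteq X\}$ (over all subspaces $M$) and $hl^*(X)=\sup\{hl(X^n): n\in\omega\}$. Let $C_p(X)$ be the space of continuous real-valued functions on $X$ with the topology of pointwise convergence. **Theorem.** Let $K$ be a compact convex subset of a Hausdorff locally convex real topological vector space, and let $B\subseteq K$ be a boundary of $K$, that is, for every continuous affine function $f\colon K\to\mathbb R$ there is $b\in B$ with $f(b)=\max_{x\in K}f(x)$. If $C_p(B)$ is a Fréchet–Urysohn space (a point lies in the closure of a set only if some sequence in the set converges to it), then $w(K)\le hl^*(B)$. -/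

import Mathlib

open Cardinal

universe u

/-- The weight `w(X)`: the least cardinality of a base of `X`, plus `ω`. -/
noncomputable def weight (X : Type u) [TopologicalSpace X] : Cardinal.{u} :=
  sInf {κ | ∃ 𝓑 : Set (Set X), TopologicalSpace.IsTopologicalBasis 𝓑 ∧ #𝓑 = κ} + ℵ₀

/-- The Lindelöf number `l(X)`: the least `κ` such that every open cover of `X` has a subcover
of cardinality at most `κ`, plus `ω`. -/
noncomputable def lindelofNumber (X : Type u) [TopologicalSpace X] : Cardinal.{u} :=
  sInf {κ | ∀ γ : Set (Set X), (∀ U ∈ γ, IsOpen U) → ⋃₀ γ = Set.univ →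
    ∃ δ : Set (Set X), δ ⊆ γ ∧ #δ ≤ κ ∧ ⋃₀ δ = Set.univ} + ℵ₀

/-- The hereditary Lindelöf number `hl(X)`: the supremum of `l(M)` over all subspaces `M` of `X`.
The supremum is that of a set-indexed family of cardinals, hence of a bounded one. -/
noncomputable def hereditaryLindelofNumber (X : Type u) [TopologicalSpace X] : Cardinal.{u} :=
  ⨆ M : Set X, lindelofNumber M

/-- `hl*(X)`: the supremum of `hl(Xⁿ)` over the finite powers of `X`. -/
noncomputable def hereditaryLindelofStar (X : Type u) [TopologicalSpace X] : Cardinal.{u} :=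
  ⨆ n : ℕ, hereditaryLindelofNumber (Fin n → X)

/-- `C_p(X)`: the continuous real-valued functions on `X`, with the topology of pointwise
convergence, which is the subspace topology inherited from the product `X → ℝ`. -/
abbrev Cp (X : Type u) [TopologicalSpace X] : Type u := {f : X → ℝ // Continuous f}

/-- The restriction of `f` to `K` is a continuous affine function on the convex set `K`.
The values of `f` outside `K` are irrelevant. -/
def IsContinuousAffineOn {E : Type u} [AddCommGroup E] [Module ℝ E] [TopologicalSpace E]
    (f : E → ℝ) (K : Set E) : Prop :=
  ContinuousOn f K ∧ ∀ x ∈ K, ∀ y ∈ K, ∀ a b : ℝ, 0 ≤ a → 0 ≤ b → a + b = 1 →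
    f (a • x + b • y) = a * f x + b * f y

/-- `B` is a boundary of `K`: `B ⊆ K`, and every continuous affine function on `K` attains its
maximum over `K` at some point of `B`. -/
def IsBoundaryOf {E : Type u} [AddCommGroup E] [Module ℝ E] [TopologicalSpace E]
    (B K : Set E) : Prop :=
  B ⊆ K ∧ ∀ f : E → ℝ, IsContinuousAffineOn f K → ∃ b ∈ B, ∀ x ∈ K, f x ≤ f b

/-! Restrict the unit ball of continuous affine functions on `K` to `B`. The hereditary density of
`C_p(B)` is at most `hl*(B)` (`exists_dense_subset_Cp`), so these restrictions have a pointwise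
dense subset `D` of at most that size. By the Fréchet–Urysohn property each function of the ball is,
on `B`, the limit of a sequence from `D`. Simons' argument
(`zero_mem_closure_convexHull_of_tendsto_on_boundary`), which works with sequences, turns this into
norm approximation on `K` by convex combinations. Hence points of `K` that lifts of `D` do not
separate are separated by no continuous affine function, and coincide by Hahn–Banach. The compact
set `K` thus embeds in `ℝ^D`, which bounds its weight (`weight_le_of_separating`). -/

theorem aleph0_le_lindelofNumber (X : Type u) [TopologicalSpace X] : ℵ₀ ≤ lindelofNumber X :=
  self_le_add_left _ _

theorem lindelofNumber_le_hereditary {X : Type u} [TopologicalSpace X] (M : Set X) :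
    lindelofNumber M ≤ hereditaryLindelofNumber X :=
  le_ciSup (f := fun M : Set X => lindelofNumber M) Cardinal.bddAbove_of_small M

theorem hereditaryLindelofNumber_pow_le_star (X : Type u) [TopologicalSpace X] (n : ℕ) :
    hereditaryLindelofNumber (Fin n → X) ≤ hereditaryLindelofStar X :=
  le_ciSup (f := fun n : ℕ => hereditaryLindelofNumber (Fin n → X))
    Cardinal.bddAbove_of_small n

theorem aleph0_le_hereditaryLindelofStar (X : Type u) [TopologicalSpace X] :
    ℵ₀ ≤ hereditaryLindelofStar X :=
  (aleph0_le_lindelofNumber _).trans ((lindelofNumber_le_hereditary (X := Fin 0 → X) Set.univ).trans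
    (hereditaryLindelofNumber_pow_le_star X 0))

theorem exists_subcover_le_lindelofNumber {X : Type u} [TopologicalSpace X] (γ : Set (Set X))
    (hγ : ∀ U ∈ γ, IsOpen U) (hcov : ⋃₀ γ = Set.univ) :
    ∃ δ ⊆ γ, #δ ≤ lindelofNumber X ∧ ⋃₀ δ = Set.univ := by
  have hne : {κ : Cardinal.{u} | ∀ γ : Set (Set X), (∀ U ∈ γ, IsOpen U) → ⋃₀ γ = Set.univ →
      ∃ δ : Set (Set X), δ ⊆ γ ∧ #δ ≤ κ ∧ ⋃₀ δ = Set.univ}.Nonempty :=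
    ⟨#(Set X), fun γ _ h => ⟨γ, subset_rfl, mk_set_le γ, h⟩⟩
  obtain ⟨δ, h1, h2, h3⟩ := csInf_mem hne γ hγ hcov
  exact ⟨δ, h1, h2.trans (self_le_add_right _ _), h3⟩

/-- A family of open sets has a subfamily of size at most `hl(X)` with the same union. -/
theorem exists_subfamily_iUnion_eq {X ι : Type u} [TopologicalSpace X] (U : ι → Set X)
    (hU : ∀ i, IsOpen (U i)) :
    ∃ J : Set ι, #J ≤ hereditaryLindelofNumber X ∧ ∀ i, ∀ x ∈ U i, ∃ j ∈ J, x ∈ U j := by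
  let M : Set X := ⋃ i, U i
  let W : ι → Set M := fun i => Subtype.val ⁻¹' U i
  obtain ⟨δ, hδ, hcard, hcov⟩ := exists_subcover_le_lindelofNumber (Set.range W)
    (by rintro _ ⟨i, rfl⟩; exact (hU i).preimage continuous_subtype_val)
    (by
      refine Set.eq_univ_of_forall fun x => ?_
      obtain ⟨i, hi⟩ := Set.mem_iUnion.1 x.2
      exact ⟨W i, ⟨i, rfl⟩, hi⟩)
  choose c hc using fun V : δ => hδ V.2
  refine ⟨Set.range c, mk_range_le.trans
    (hcard.trans (lindelofNumber_le_hereditary M)), fun i x hx => ?_⟩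
  have hx' : (⟨x, Set.mem_iUnion.2 ⟨i, hx⟩⟩ : M) ∈ ⋃₀ δ := hcov ▸ Set.mem_univ _
  obtain ⟨V, hV, hxV⟩ := hx'
  refine ⟨c ⟨V, hV⟩, ⟨⟨V, hV⟩, rfl⟩, ?_⟩
  rw [← show W (c ⟨V, hV⟩) = V from hc ⟨V, hV⟩] at hxV
  exact hxV

/-! ### Hereditary density of `C_p(X)` -/

/-- The hereditary density of `C_p(X)` is at most `hl*(X)`. -/
theorem exists_dense_subset_Cp {X : Type u} [TopologicalSpace X] (F : Set (Cp X)) :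
    ∃ D ⊆ F, #D ≤ hereditaryLindelofStar X ∧ F ⊆ closure D := by
  -- A basic neighbourhood is given by a tuple `x` and rational intervals `q`. With `(n, q)` fixed
  -- and `x` varying, each `f` defines an open subset of `Xⁿ`, so `hl(Xⁿ)` bounds the number of
  -- functions needed. There are only countably many pairs `(n, q)`.
  have key : ∀ i : (n : ℕ) × (Fin n → ℚ × ℚ), ∃ J : Set F,
      #J ≤ hereditaryLindelofStar X ∧ ∀ f : F, ∀ x : Fin i.1 → X,
        (∀ k, f.1.1 (x k) ∈ Set.Ioo ((i.2 k).1 : ℝ) (i.2 k).2) →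
        ∃ g ∈ J, ∀ k, g.1.1 (x k) ∈ Set.Ioo ((i.2 k).1 : ℝ) (i.2 k).2 := by
    rintro ⟨n, q⟩
    obtain ⟨J, hJ, h⟩ := exists_subfamily_iUnion_eq
      (fun f : F => {x : Fin n → X | ∀ k, f.1.1 (x k) ∈ Set.Ioo ((q k).1 : ℝ) (q k).2})
      (fun f => by
        simp only [Set.ofPred_forall]
        exact isOpen_iInter_of_finite fun k =>
          isOpen_Ioo.preimage (f.1.2.comp (continuous_apply k)))
    exact ⟨J, hJ.trans (hereditaryLindelofNumber_pow_le_star X n), h⟩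
  choose J hJ hJcov using key
  refine ⟨⋃ i : ULift.{u} ((n : ℕ) × (Fin n → ℚ × ℚ)), Subtype.val '' J i.down, ?_, ?_, ?_⟩
  · simp only [Set.iUnion_subset_iff]
    rintro i _ ⟨f, -, rfl⟩
    exact f.2
  · refine (mk_iUnion_le _).trans (mul_le_of_le (aleph0_le_hereditaryLindelofStar X)
      (mk_le_aleph0.trans (aleph0_le_hereditaryLindelofStar X)) ?_)
    exact ciSup_le' fun i => mk_image_le.trans (hJ _)
  · intro f hf
    rw [mem_closure_iff_nhds]
    intro s hs
    rw [nhds_subtype_eq_comap, Filter.mem_comap] at hs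
    obtain ⟨t, ht, hts⟩ := hs
    rw [nhds_pi, Filter.mem_pi] at ht
    obtain ⟨I, hI, V, hV, hVt⟩ := ht
    have hq : ∀ x, ∃ q : ℚ × ℚ, f.1 x ∈ Set.Ioo (q.1 : ℝ) q.2 ∧ Set.Ioo (q.1 : ℝ) q.2 ⊆ V x := by
      intro x
      obtain ⟨_, hu, hxu, huV⟩ := Real.isTopologicalBasis_Ioo_rat.mem_nhds_iff.1 (hV x)
      simp only [Set.mem_iUnion, Set.mem_singleton_iff] at hu
      obtain ⟨a, b, -, rfl⟩ := hu
      exact ⟨(a, b), hxu, huV⟩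
    choose q hfq hqV using hq
    have := hI.to_subtype
    obtain ⟨n, ⟨e⟩⟩ := Finite.exists_equiv_fin I
    obtain ⟨g, hg, hgq⟩ := hJcov ⟨n, fun k => q (e.symm k)⟩ ⟨f, hf⟩ (fun k => e.symm k)
      (fun k => hfq _)
    refine ⟨g.1, hts (hVt fun x hx => hqV x ?_), Set.mem_iUnion.2 ⟨⟨_⟩, g, hg, rfl⟩⟩
    simpa using hgq (e ⟨x, hx⟩)

/-! ### Weight and separating families -/

/-- A compact space whose points are separated by a set `D` of continuous functions has weight at
most `#D + ω`. -/
theorem weight_le_of_separating {X : Type u} [TopologicalSpace X] [CompactSpace X]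
    (D : Set C(X, ℝ)) (κ : Cardinal.{u}) (hκ : ℵ₀ ≤ κ) (hD : #D ≤ κ)
    (hsep : ∀ x y, (∀ f ∈ D, f x = f y) → x = y) : weight X ≤ κ := by
  let Φ : X → D → ℝ := fun x f => f.1 x
  have hΦ : Topology.IsInducing Φ :=
    (Continuous.isClosedEmbedding (continuous_pi fun f => f.1.continuous)
      (fun x y h => hsep x y fun f hf => congrFun h ⟨f, hf⟩)).isInducing
  let S : Set (Set X) := Set.range fun i : D × ℚ × ℚ => i.1.1 ⁻¹' Set.Ioo (i.2.1 : ℝ) i.2.2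
  have hgen : ‹TopologicalSpace X› = TopologicalSpace.generateFrom S := by
    refine le_antisymm (le_generateFrom ?_) ?_
    · rintro _ ⟨i, rfl⟩
      exact isOpen_Ioo.preimage i.1.1.continuous
    · rw [hΦ.eq_induced, Pi.topologicalSpace, induced_iInf]
      refine le_iInf fun f => ?_
      rw [induced_compose, ← continuous_iff_le_induced]
      let : TopologicalSpace X := TopologicalSpace.generateFrom S
      refine Real.isTopologicalBasis_Ioo_rat.continuous_iff.2 ?_
      intro s hs
      simp only [Set.mem_iUnion, Set.mem_singleton_iff] at hs
      obtain ⟨a, b, -, rfl⟩ := hs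
      exact TopologicalSpace.isOpen_generateFrom_of_mem ⟨(f, a, b), rfl⟩
  have hS : #S ≤ κ := by
    refine mk_range_le.trans ?_
    rw [mk_prod]
    simp only [lift_id']
    exact mul_le_of_le hκ hD ((lift_le_aleph0.2 mk_le_aleph0).trans hκ)
  have hbasis := TopologicalSpace.isTopologicalBasis_of_subbasis hgen
  have hcard : #((fun f : Set (Set X) => ⋂₀ f) '' {f | f.Finite ∧ f ⊆ S}) ≤ κ := by
    have hsub : ((fun f : Set (Set X) => ⋂₀ f) '' {f | f.Finite ∧ f ⊆ S}) ⊆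
        Set.range fun t : Finset S => ⋂₀ (Subtype.val '' (t : Set S)) := by
      rintro _ ⟨f, ⟨hf, hfS⟩, rfl⟩
      refine ⟨(hf.preimage Subtype.val_injective.injOn).toFinset, ?_⟩
      simp [Set.inter_eq_self_of_subset_right hfS]
    refine (mk_le_mk_of_subset hsub).trans (mk_range_le.trans ?_)
    rcases finite_or_infinite S with h | h
    · exact mk_le_aleph0.trans hκ
    · rwa [mk_finset_of_infinite]
  refine add_le_of_le hκ (le_trans (csInf_le' ⟨_, hbasis, rfl⟩) hcard) hκ

/-! ### Simons' inequality -/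

/-- A consequence of Simons' inequality: if a bounded sequence in a closed subspace of `C(X)`
converges to zero on a norm-attaining set, then some convex combinations are small in norm. -/
theorem zero_mem_closure_convexHull_of_tendsto_on_boundary {X : Type u} [TopologicalSpace X]
    [CompactSpace X] (A : Submodule ℝ C(X, ℝ)) (hA : IsClosed (A : Set C(X, ℝ))) (S : Set X)
    (hS : ∀ f ∈ A, ∃ b ∈ S, ‖f‖ ≤ |f b|) (f : ℕ → C(X, ℝ)) (hfA : ∀ n, f n ∈ A) (M : ℝ)
    (hM : ∀ n, ‖f n‖ ≤ M)
    (hf : ∀ b ∈ S, Filter.Tendsto (fun n => f n b) Filter.atTop (nhds 0)) :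
    0 ∈ closure (convexHull ℝ (Set.range f)) := by
  by_contra hcon
  obtain ⟨a, ha, hball⟩ : ∃ a > 0, ∀ g ∈ convexHull ℝ (Set.range f), a ≤ ‖g‖ := by
    rw [Metric.mem_closure_iff] at hcon
    push Not at hcon
    obtain ⟨a, ha, h⟩ := hcon
    exact ⟨a, ha, fun g hg => by simpa using h g hg⟩
  let C : ℕ → Set C(X, ℝ) := fun k => convexHull ℝ (f '' Set.Ici k)
  have hCne : ∀ k, (C k).Nonempty := fun k => ⟨f k, subset_convexHull ℝ _ ⟨k, Set.self_mem_Ici, rfl⟩⟩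
  have hCconv : ∀ k, Convex ℝ (C k) := fun k => convex_convexHull ℝ _
  have hCmono : ∀ k, C (k + 1) ⊆ C k := fun k =>
    convexHull_mono (Set.image_mono (Set.Ici_subset_Ici.2 k.le_succ))
  have hCA : ∀ k, C k ⊆ A := fun k =>
    convexHull_min (by rintro _ ⟨n, -, rfl⟩; exact hfA n) A.convex
  have hCM : ∀ k, ∀ y ∈ C k, ‖y‖ ≤ M := by
    intro k y hy
    have : C k ⊆ Metric.closedBall 0 M :=
      convexHull_min (by rintro _ ⟨n, -, rfl⟩; simpa using hM n) (convex_closedBall 0 M)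
    simpa using this hy
  have hCb : ∀ k, ∀ b, ∀ ε : ℝ, (∀ n, k ≤ n → |f n b| ≤ ε) → ∀ y ∈ C k, |y b| ≤ ε := by
    intro k b ε h y hy
    have hconv : Convex ℝ {y : C(X, ℝ) | |y b| ≤ ε} := by
      intro y hy z hz s t hs ht hst
      have hy : |y b| ≤ ε := hy
      have hz : |z b| ≤ ε := hz
      have : s • y b + t • z b ∈ Set.Icc (-ε) ε :=
        convex_Icc (-ε) ε (abs_le.1 hy) (abs_le.1 hz) hs ht hst
      exact abs_le.2 this
    exact convexHull_min (by rintro _ ⟨n, hn, rfl⟩; exact h n hn) hconv hy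
  -- Chosen so that `a - 12η = a / 2`, which beats the tail bound `a / 4` at the end.
  let η : ℝ := a / 24
  have hη : 0 < η := by positivity
  -- The weights `2^{-(j+1)}` with `j ≥ k` sum to `2^{-k}`, so `v + 2^{-k} y` is the limit reached
  -- from `v` if `y` is repeated forever. Its norm is nearly minimised over the tail hull `C k`.
  have hchoice : ∀ (k : ℕ) (v : C(X, ℝ)), ∃ y ∈ C k, ∀ z ∈ C k,
      ‖v + (1 / 2 : ℝ) ^ k • y‖ ≤ ‖v + (1 / 2 : ℝ) ^ k • z‖ + 3 * η * (1 / 4) ^ k := by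
    intro k v
    let T : Set ℝ := (fun z => ‖v + (1 / 2 : ℝ) ^ k • z‖) '' C k
    have hT : BddBelow T := ⟨0, by rintro _ ⟨z, -, rfl⟩; exact norm_nonneg _⟩
    obtain ⟨_, ⟨y, hy, rfl⟩, hlt⟩ := exists_lt_of_csInf_lt ((hCne k).image _)
      (lt_add_of_pos_right (sInf T) (by positivity : 0 < 3 * η * (1 / 4) ^ k))
    exact ⟨y, hy, fun z hz => hlt.le.trans (by gcongr; exact csInf_le hT ⟨z, hz, rfl⟩)⟩
  choose c hcC hcmin using hchoice
  let v : ℕ → C(X, ℝ) := fun k => Nat.rec 0 (fun k w => w + (1 / 2 : ℝ) ^ (k + 1) • c k w) k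
  let y : ℕ → C(X, ℝ) := fun k => c k (v k)
  have hv0 : v 0 = 0 := rfl
  have hvs : ∀ k, v (k + 1) = v k + (1 / 2 : ℝ) ^ (k + 1) • y k := fun k => rfl
  have hyC : ∀ k, y k ∈ C k := fun k => hcC k _
  have hvA : ∀ k, v k ∈ A := by
    intro k
    induction k with
    | zero => exact A.zero_mem
    | succ k ih => rw [hvs]; exact A.add_mem ih (A.smul_mem _ (hCA k (hyC k)))
  have hvdist : ∀ k, dist (v k) (v (k + 1)) ≤ M / 2 / 2 ^ k := by
    intro k
    rw [hvs, dist_self_add_right, norm_smul]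
    have h1 := hCM k _ (hyC k)
    have h2 : ‖(1 / 2 : ℝ) ^ (k + 1)‖ = 1 / 2 / 2 ^ k := by
      rw [Real.norm_of_nonneg (by positivity)]; simp [pow_succ]; ring
    rw [h2]
    calc 1 / 2 / 2 ^ k * ‖y k‖ ≤ 1 / 2 / 2 ^ k * M := by gcongr
      _ = _ := by ring
  obtain ⟨w, hw⟩ := cauchySeq_tendsto_of_complete (cauchySeq_of_le_geometric_two hvdist)
  have hwA : w ∈ A := hA.mem_of_tendsto hw (Filter.Eventually.of_forall hvA)
  let p : ℕ → ℝ := fun k => ‖v k + (1 / 2 : ℝ) ^ k • y k‖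
  -- The midpoint of `y k` and `y (k + 1)` competes with `y k`, and gives exactly the vector whose
  -- norm is `p (k + 1)`.
  have hpstep : ∀ k, p k ≤ p (k + 1) + 3 * η * (1 / 4) ^ k := by
    intro k
    have hz : (1 / 2 : ℝ) • y k + (1 / 2 : ℝ) • y (k + 1) ∈ C k :=
      hCconv k (hyC k) (hCmono k (hyC (k + 1))) (by norm_num) (by norm_num) (by norm_num)
    have := hcmin k (v k) _ hz
    have he : v k + (1 / 2 : ℝ) ^ k • ((1 / 2 : ℝ) • y k + (1 / 2 : ℝ) • y (k + 1)) =
        v (k + 1) + (1 / 2 : ℝ) ^ (k + 1) • y (k + 1) := by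
      rw [hvs, pow_succ]; module
    rwa [he] at this
  -- The correction `4η·4^{-k}` drops by exactly `3η·4^{-k}` at each step, absorbing the error.
  have hpmono : Monotone fun k => p k - 4 * η * (1 / 4) ^ k := by
    refine monotone_nat_of_le_succ fun k => ?_
    have := hpstep k
    rw [pow_succ]
    linarith
  have hy0 : Filter.Tendsto (fun k => (1 / 2 : ℝ) ^ k • y k) Filter.atTop (nhds 0) := by
    have h0 : Filter.Tendsto (fun k : ℕ => (1 / 2 : ℝ) ^ k * M) Filter.atTop (nhds 0) := by
      simpa using (tendsto_pow_atTop_nhds_zero_of_lt_one (r := (1 / 2 : ℝ)) (by norm_num)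
        (by norm_num)).mul_const M
    refine squeeze_zero_norm (fun k => ?_) h0
    rw [norm_smul, Real.norm_of_nonneg (by positivity)]
    gcongr
    exact hCM k _ (hyC k)
  have hplim : Filter.Tendsto (fun k => p k - 4 * η * (1 / 4) ^ k) Filter.atTop (nhds ‖w‖) := by
    have h1 : Filter.Tendsto p Filter.atTop (nhds ‖w‖) := by
      have := (hw.add hy0).norm
      rwa [add_zero] at this
    have h2 := (tendsto_pow_atTop_nhds_zero_of_lt_one (r := (1 / 4 : ℝ)) (by norm_num)
        (by norm_num)).const_mul (4 * η)
    simpa using h1.sub h2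
  have hple : ∀ k, p k - 4 * η * (1 / 4) ^ k ≤ ‖w‖ := fun k => hpmono.ge_of_tendsto hplim k
  have hwa : a - 4 * η ≤ ‖w‖ := by
    have h1 := hple 0
    have h2 : a ≤ p 0 := by
      have : p 0 = ‖y 0‖ := by simp [p, hv0]
      rw [this]
      exact hball _ (convexHull_mono (Set.image_subset_range _ _) (hyC 0))
    simp only [pow_zero, mul_one] at h1
    linarith
  -- Induction, as `v (k + 1)` is the midpoint of `v k` and a vector of norm `p k ≤ ‖w‖ +
  -- 4η·4^{-k}`.
  have hd : ∀ k, (1 / 2 : ℝ) ^ k * (‖w‖ - 8 * η) + 8 * η * (1 / 4) ^ k ≤ ‖w‖ - ‖v k‖ := by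
    intro k
    induction k with
    | zero => simp [hv0]
    | succ k ih =>
      have h1 : ‖v (k + 1)‖ ≤ 1 / 2 * ‖v k‖ + 1 / 2 * p k := by
        have he : v (k + 1) = (1 / 2 : ℝ) • v k + (1 / 2 : ℝ) • (v k + (1 / 2 : ℝ) ^ k • y k) := by
          rw [hvs, pow_succ]; module
        rw [he]
        refine (norm_add_le _ _).trans ?_
        rw [norm_smul, norm_smul, Real.norm_of_nonneg (by norm_num)]
      have h2 := hple k
      rw [pow_succ, pow_succ]
      linarith
  -- Where `w` attains its norm, the gap `‖w‖ - ‖v k‖` is at most `|w b - v k b| ≤ (a / 4)·2^{-k}`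
  -- for a suitable `k`, whereas `hd` makes it exceed `(a / 2)·2^{-k}`.
  obtain ⟨b, hbS, hb⟩ := hS w hwA
  obtain ⟨k, hk⟩ : ∃ k, ∀ n, k ≤ n → |f n b| ≤ a / 4 := by
    obtain ⟨k, hk⟩ := Metric.tendsto_atTop.1 (hf b hbS) (a / 4) (by positivity)
    exact ⟨k, fun n hn => by simpa using (hk n hn).le⟩
  have hyb : ∀ n, k ≤ n → |y n b| ≤ a / 4 := fun n hn =>
    hCb n b _ (fun m hm => hk m (hn.trans hm)) _ (hyC n)
  have htail : |v k b - w b| ≤ a / 4 * (1 / 2) ^ k := by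
    have hstep : ∀ n, dist (v (n + k) b) (v (n + 1 + k) b) ≤
        (a / 4 * (1 / 2) ^ k) * 2⁻¹ / 2 ^ n := by
      intro n
      rw [show n + 1 + k = n + k + 1 by ring, hvs]
      simp only [ContinuousMap.add_apply, ContinuousMap.smul_apply, dist_self_add_right, norm_smul]
      rw [Real.norm_of_nonneg (by positivity : (0 : ℝ) ≤ (1 / 2) ^ (n + k + 1)), Real.norm_eq_abs]
      calc (1 / 2 : ℝ) ^ (n + k + 1) * |y (n + k) b| ≤ (1 / 2 : ℝ) ^ (n + k + 1) * (a / 4) := by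
            gcongr; exact hyb _ (by omega)
        _ = _ := by rw [pow_succ, pow_add]; simp; ring
    have hlim : Filter.Tendsto (fun n => v (n + k) b) Filter.atTop (nhds (w b)) :=
      (Filter.tendsto_add_atTop_iff_nat (f := fun n => v n b) k).2
        (((ContinuousMap.evalCLM ℝ b : C(X, ℝ) →L[ℝ] ℝ).continuous.tendsto w).comp hw)
    have := dist_le_of_le_geometric_two_of_tendsto₀ (f := fun n => v (n + k) b)
      (C := a / 4 * (1 / 2) ^ k) (by simpa [div_eq_mul_inv] using hstep) hlim
    simpa [Real.dist_eq] using this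
  have h1 : |v k b| ≤ ‖v k‖ := (v k).norm_coe_le_norm b
  have h2 := hd k
  have h3 : |w b| - |v k b| ≤ |v k b - w b| := by
    rw [abs_sub_comm]; exact abs_sub_abs_le_abs_sub _ _
  have hk0 : (0 : ℝ) < (1 / 2) ^ k := by positivity
  have hk1 : (0 : ℝ) < (1 / 4) ^ k := by positivity
  have h4 : (1 / 2 : ℝ) ^ k * (a / 2) ≤ (1 / 2 : ℝ) ^ k * (‖w‖ - 8 * η) := by
    gcongr
    simp only [η] at hwa ⊢
    linarith
  nlinarith [mul_pos hη hk1, mul_pos ha hk0]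

/-! ### Affine functions and boundaries -/

/-- The continuous affine functions on a convex set `K`, as a subspace of `C(K)`. -/
def continuousAffineSubmodule {E : Type u} [AddCommGroup E] [Module ℝ E] [TopologicalSpace E]
    (K : Set E) (hK : Convex ℝ K) : Submodule ℝ C(K, ℝ) where
  carrier := {f | ∀ (x y : K) (a b : ℝ) (ha : 0 ≤ a) (hb : 0 ≤ b) (hab : a + b = 1),
    f ⟨a • x.1 + b • y.1, hK x.2 y.2 ha hb hab⟩ = a * f x + b * f y}
  add_mem' {f g} hf hg x y a b ha hb hab := by
    simp only [ContinuousMap.add_apply, hf x y a b ha hb hab, hg x y a b ha hb hab]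
    ring
  zero_mem' x y a b ha hb hab := by simp
  smul_mem' c f hf x y a b ha hb hab := by
    simp only [ContinuousMap.smul_apply, hf x y a b ha hb hab, smul_eq_mul]
    ring

section Affine

variable {E : Type u} [AddCommGroup E] [Module ℝ E] [TopologicalSpace E] {K B : Set E}

theorem isClosed_continuousAffineSubmodule (hK : Convex ℝ K) :
    IsClosed (continuousAffineSubmodule K hK : Set C(K, ℝ)) := by
  have : (continuousAffineSubmodule K hK : Set C(K, ℝ)) =
      {f | ∀ (x y : K) (a b : ℝ) (ha : 0 ≤ a) (hb : 0 ≤ b) (hab : a + b = 1),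
        f ⟨a • x.1 + b • y.1, hK x.2 y.2 ha hb hab⟩ = a * f x + b * f y} := rfl
  rw [this]
  simp only [Set.ofPred_forall]
  refine isClosed_iInter fun x => isClosed_iInter fun y => isClosed_iInter fun a =>
    isClosed_iInter fun b => isClosed_iInter fun ha => isClosed_iInter fun hb =>
    isClosed_iInter fun hab => isClosed_eq (by fun_prop) (by fun_prop)

theorem exists_max_of_mem_continuousAffineSubmodule (hK : Convex ℝ K) (hB : IsBoundaryOf B K)
    {f : C(K, ℝ)} (hf : f ∈ continuousAffineSubmodule K hK) :
    ∃ b : K, b.1 ∈ B ∧ ∀ x, f x ≤ f b := by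
  classical
  let F : E → ℝ := fun x => if h : x ∈ K then f ⟨x, h⟩ else 0
  have hF : ∀ x : K, F x = f x := fun x => dif_pos x.2
  obtain ⟨b, hb, hmax⟩ := hB.2 F ⟨by
      rw [continuousOn_iff_continuous_domRestrict]
      exact f.continuous.congr fun x => (hF x).symm, by
      intro x hx y hy a b ha hb hab
      have := hf ⟨x, hx⟩ ⟨y, hy⟩ a b ha hb hab
      rw [← hF, ← hF, ← hF] at this
      exact this⟩
  refine ⟨⟨b, hB.1 hb⟩, hb, fun x => ?_⟩
  rw [← hF, ← hF]
  exact hmax x x.2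

/-- The boundary property of `f` and of `-f` yields a maximum and a minimum on `B`, and one of them
carries the norm. -/
theorem exists_norm_le_of_mem_continuousAffineSubmodule [CompactSpace K] (hK : Convex ℝ K)
    (hB : IsBoundaryOf B K) {f : C(K, ℝ)} (hf : f ∈ continuousAffineSubmodule K hK) :
    ∃ b ∈ (Subtype.val ⁻¹' B : Set K), ‖f‖ ≤ |f b| := by
  obtain ⟨b, hb, hmax⟩ := exists_max_of_mem_continuousAffineSubmodule hK hB hf
  obtain ⟨c, hc, hmin⟩ := exists_max_of_mem_continuousAffineSubmodule hK hB
    ((continuousAffineSubmodule K hK).neg_mem hf)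
  have hle : ‖f‖ ≤ max |f b| |f c| := by
    refine (ContinuousMap.norm_le f (le_max_of_le_left (abs_nonneg _))).2 fun x => ?_
    have h1 := hmax x
    have h2 := hmin x
    simp only [ContinuousMap.neg_apply, neg_le_neg_iff] at h2
    rw [Real.norm_eq_abs, abs_le']
    exact ⟨(h1.trans (le_abs_self _)).trans (le_max_left _ _),
      ((neg_le_neg h2).trans (neg_le_abs _)).trans (le_max_right _ _)⟩
  rcases le_max_iff.1 hle with h | h
  · exact ⟨b, hb, h⟩
  · exact ⟨c, hc, h⟩

/-- If a bounded sequence of continuous affine functions converges on the boundary to such a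
function, then the limit is a norm limit of convex combinations. -/
theorem mem_closure_convexHull_of_tendsto_on_boundary [CompactSpace K] (hK : Convex ℝ K)
    (hB : IsBoundaryOf B K) {g : ℕ → C(K, ℝ)} {f : C(K, ℝ)} (M : ℝ)
    (hg : ∀ n, g n ∈ continuousAffineSubmodule K hK) (hf : f ∈ continuousAffineSubmodule K hK)
    (hM : ∀ n, ‖g n‖ ≤ M)
    (h : ∀ b : K, b.1 ∈ B → Filter.Tendsto (fun n => g n b) Filter.atTop (nhds (f b))) :
    f ∈ closure (convexHull ℝ (Set.range g)) := by
  have h0 := zero_mem_closure_convexHull_of_tendsto_on_boundary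
    (continuousAffineSubmodule K hK) (isClosed_continuousAffineSubmodule hK) (Subtype.val ⁻¹' B)
    (fun f hf => exists_norm_le_of_mem_continuousAffineSubmodule hK hB hf) (fun n => g n - f)
    (fun n => Submodule.sub_mem _ (hg n) hf) (M + ‖f‖)
    (fun n => (norm_sub_le _ _).trans (by gcongr; exact hM n))
    (fun b hb => by simpa using (h b hb).sub_const (f b))
  -- Translation by `-f` commutes with convex hulls and closures, so the statement at `0` moves back
  -- to `f`.
  have hr : Set.range (fun n => g n - f) = (fun z => z + -f) '' Set.range g := by
    rw [← Set.range_comp]; simp [Function.comp_def, sub_eq_add_neg]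
  have hr' : convexHull ℝ (Set.range fun n => g n - f) =
      (fun z => z + -f) '' convexHull ℝ (Set.range g) := by
    rw [hr]
    exact ((AffineEquiv.vaddConst ℝ (-f)).toAffineMap.image_convexHull (Set.range g)).symm
  rw [hr'] at h0
  have := (Homeomorph.addRight (-f)).image_closure (convexHull ℝ (Set.range g))
  simp only [Homeomorph.coe_addRight] at this
  rw [← this] at h0
  obtain ⟨z, hz, hz0⟩ := h0
  rwa [← add_neg_eq_zero.1 hz0]

end Affine

/-! ### The weight of `K` -/

theorem theoremt {E : Type u} [AddCommGroup E] [Module ℝ E] [TopologicalSpace E]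
    [IsTopologicalAddGroup E] [ContinuousSMul ℝ E] [LocallyConvexSpace ℝ E] [T2Space E]
    (K B : Set E) (hKconv : Convex ℝ K) (hKcomp : IsCompact K) (hB : IsBoundaryOf B K)
    (hFU : FrechetUrysohnSpace (Cp B)) :
    weight K ≤ hereditaryLindelofStar B := by
  have : CompactSpace K := isCompact_iff_compactSpace.1 hKcomp
  let A := continuousAffineSubmodule K hKconv
  let ball : Set C(K, ℝ) := {f | f ∈ A ∧ ‖f‖ ≤ 1}
  let ρ : C(K, ℝ) → Cp B := fun f =>
    ⟨fun b => f ⟨b, hB.1 b.2⟩, f.continuous.comp (by fun_prop)⟩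
  obtain ⟨D, hDF, hDcard, hDdense⟩ := exists_dense_subset_Cp (ρ '' ball)
  have hlift : ∀ d : Cp B, ∃ f : C(K, ℝ), d ∈ D → f ∈ ball ∧ ρ f = d := fun d => by
    by_cases hd : d ∈ D
    · obtain ⟨f, hf⟩ := hDF hd
      exact ⟨f, fun _ => hf⟩
    · exact ⟨0, fun h => absurd h hd⟩
  choose σ hσρ using hlift
  have hσ : ∀ {d}, d ∈ D → σ d ∈ ball := fun h => (hσρ _ h).1
  have hρσ : ∀ {d}, d ∈ D → ρ (σ d) = d := fun h => (hσρ _ h).2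
  refine weight_le_of_separating (σ '' D) _ (aleph0_le_hereditaryLindelofStar B)
    (mk_image_le.trans hDcard) fun x y hxy => ?_
  have hball : ∀ f ∈ ball, f x = f y := by
    intro f hf
    obtain ⟨g, hgD, hg⟩ := mem_closure_iff_seq_limit.1 (hDdense ⟨f, hf, rfl⟩)
    have hmem := mem_closure_convexHull_of_tendsto_on_boundary hKconv hB (f := f)
      (g := fun n => σ (g n)) 1 (fun n => (hσ (hgD n)).1) hf.1 (fun n => (hσ (hgD n)).2) (by
        intro b hb
        have h1 := tendsto_pi_nhds.1 ((continuous_subtype_val.tendsto _).comp hg) ⟨b, hb⟩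
        refine h1.congr fun n => ?_
        exact (congrFun (congrArg Subtype.val (hρσ (hgD n))) ⟨b, hb⟩).symm)
    let L : C(K, ℝ) →L[ℝ] ℝ := ContinuousMap.evalCLM ℝ x - ContinuousMap.evalCLM ℝ y
    have hsub : closure (convexHull ℝ (Set.range fun n => σ (g n))) ⊆
        (LinearMap.ker L.toLinearMap : Set C(K, ℝ)) := by
      refine closure_minimal (convexHull_min ?_ (Submodule.convex _)) L.isClosed_ker
      rintro _ ⟨n, rfl⟩
      have := hxy _ ⟨g n, hgD n, rfl⟩
      simpa [L, sub_eq_zero] using this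
    have := hsub hmem
    simpa [L, sub_eq_zero] using this
  by_contra hne
  obtain ⟨l, hl⟩ := SeparatingDual.exists_separating_of_ne (R := ℝ)
    (show (x : E) ≠ y from fun h => hne (Subtype.ext h))
  let φ : C(K, ℝ) := ⟨fun z => l z, by fun_prop⟩
  have hφ : φ ∈ A := by
    intro x y a b ha hb hab
    simp [φ]
  -- Scaling by `1 + ‖φ‖` puts `φ` in the ball without dividing by zero.
  have h1 := hball ((1 + ‖φ‖)⁻¹ • φ) ⟨A.smul_mem _ hφ, by
    rw [norm_smul, Real.norm_of_nonneg (by positivity), inv_mul_le_one₀ (by positivity)]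
    linarith⟩
  have h2 : (1 + ‖φ‖)⁻¹ ≠ 0 := by positivity
  simp only [ContinuousMap.smul_apply, smul_eq_mul] at h1
  exact hl (mul_left_cancel₀ h2 h1)
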